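/- Let $\mathbb{K}$ be a field, $\kappa\in\mathbb{K}$. A \emph{modified Rota-Baxter AssDer pair of weight $\kappa$} is a $\mathbb{K}$-vector space $A$ with an associative (not necessarily unital) bilinear product $\mu$ and linear maps $R,d:A\to A$ such that, for all $a,b\in A$, $$\mu(Ra,Rb)=R\big(\mu(Ra,b)+\mu(a,Rb)\big)+\kappa\,\mu(a,b),\qquad d\mu(a,b)=\mu(da,b)+\mu(a,db),\qquad Rd=dR .$$ A \emph{bimodule} over it is an $(A,\mu)$-bimodule $M$ (with bilinear actions $\mathbf l:A\times M\to M$, $\mathbf r:M\times A\to M$ satisfying $\mathbf l(\mu(a,b),m)=\mathbf l(a,\mathbf l(b,m))$, $\mathbf l(a,\mathbf r(m,b))=\mathbf r(\mathbf l(a,m),b)$, $\mathbf r(m,\mu(a,b))=\mathbf r(\mathbf r(m,a),b)$) with linear maps $R_M,d_M:M\to M$ such that, for all $a\in A$, $m\in M$, $$\mathbf l(Ra,R_Mm)=R_M\big(\mathbf l(Ra,m)+\mathbf l(a,R_Mm)\big)+\kappa\,\mathbf l(a,m),\qquad \mathbf r(R_Mm,Ra)=R_M\big(\mathbf r(R_Mm,a)+\mathbf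 r(m,Ra)\big)+\kappa\,\mathbf r(m,a),$$ $$d_M\mathbf l(a,m)=\mathbf l(da,m)+\mathbf l(a,d_Mm),\qquad d_M\mathbf r(m,a)=\mathbf r(d_Mm,a)+\mathbf r(m,da),\qquad R_Md_M=d_MR_M .$$ Put $C^n=\mathrm{Hom}(A^{\otimes n},M)$ for $n\ge 1$. For $f\in C^n$ let $$\delta^n_{\mathrm{Hoch}}f(a_1,\dots,a_{n+1})=(-1)^{n+1}\mathbf l(a_1,f(a_2,\dots,a_{n+1}))+\mathbf r(f(a_1,\dots,a_n),a_{n+1})+\sum_{i=1}^n(-1)^{i+n+1}f(a_1,\dots,\mu(a_i,a_{i+1}),\dots,a_{n+1}),$$ and let $\delta^n_{\mathrm{mHoch}}$ be given by the same formula with $\mu,\mathbf l,\mathbf r$ replaced by $$\mu_R(a,b)=\mu(Ra,b)+\mu(a,Rb),\qquad \widetilde{\mathbf l}(a,m)=\mathbf l(Ra,m)-R_M\mathbf l(a,m),\qquad \widetilde{\mathbf r}(m,a)=\mathbf r(m,Ra)-R_M\mathbf r(m,a).$$ For $S\subseteq\{1,\dots,n\}$ let $b^S_j=a_j$ if $j\in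 S$ and $b^S_j=Ra_j$ if $j\notin S$. Define $\phi^n,\Delta^n:C^n\to C^n$ by $$\phi^n f(a_1,\dots,a_n)=f(Ra_1,\dots,Ra_n)-\sum_{|S|\ \mathrm{odd}}(-\kappa)^{\frac{|S|-1}{2}}R_M\big(f(b^S_1,\dots,b^S_n)\big)+\sum_{|S|\ge2\ \mathrm{even}}(-\kappa)^{\frac{|S|}{2}}f(b^S_1,\dots,b^S_n),$$ $$\Delta^nf(a_1,\dots,a_n)=\sum_{i=1}^nf(a_1,\dots,da_i,\dots,a_n)-d_Mf(a_1,\dots,a_n).$$ Let $C^1_{\mathrm{mRBAA}^\kappa}=C^1$ and $C^n_{\mathrm{mRBAA}^\kappa}=C^n\oplus C^{n-1}$ for $n\ge2$, with $$\partial^1f=(\delta^1_{\mathrm{Hoch}}f,-\phi^1f),\qquad \partial^n(f,g)=\big(\delta^n_{\mathrm{Hoch}}f,\,-\delta^{n-1}_{\mathrm{mHoch}}g-\phi^nf\big)\quad(n\ge2),$$ and extend $\Delta$ to these spaces by $\Delta^n(f,g)=(\Delta^nf,\Delta^{n-1}g)$ for $n\ge 2$. Finally let $\mathfrak C^1=C^1$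 and $\mathfrak C^n=C^n_{\mathrm{mRBAA}^\kappa}\oplus C^{n-1}_{\mathrm{mRBAA}^\kappa}$ for $n\ge2$, and define linear maps $\mathfrak D^n:\mathfrak C^n\to\mathfrak C^{n+1}$ by $$\mathfrak D^1f=(\partial^1f,-\Delta^1f),\qquad \mathfrak D^n(F,G)=\big(\partial^nF,\ \partial^{n-1}G+(-1)^n\Delta^nF\big)\quad(n\ge2).$$ Then $(\mathfrak C^\star,\mathfrak D^\star)$ is a cochain complex: $\mathfrak D^{n+1}\circ\mathfrak D^n=0$ for all $n\ge1$. -/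

import Mathlib

universe u v w

/-- A modified Rota-Baxter AssDer pair `(A, μ, R, d)` of weight `κ` on a vector space `A`:
an associative (not necessarily unital) product `μ`, a modified Rota-Baxter operator `R` of
weight `κ`, and a derivation `d` commuting with `R`. -/
structure MRBAssDerPair (𝕜 : Type u) [Field 𝕜] (κ : 𝕜) (A : Type v) [AddCommGroup A]
    [Module 𝕜 A] where
  /-- the product -/
  μ : A →ₗ[𝕜] A →ₗ[𝕜] A
  /-- the modified Rota-Baxter operator -/
  R : A →ₗ[𝕜] A
  /-- the derivation -/
  d : A →ₗ[𝕜] A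
  assoc : ∀ a b c : A, μ (μ a b) c = μ a (μ b c)
  modified_rotaBaxter : ∀ a b : A, μ (R a) (R b) = R (μ (R a) b + μ a (R b)) + κ • μ a b
  derivation : ∀ a b : A, d (μ a b) = μ (d a) b + μ a (d b)
  comm : R ∘ₗ d = d ∘ₗ R

/-- A bimodule `(M, l, r, R_M, d_M)` over a modified Rota-Baxter AssDer pair. -/
structure MRBAssDerPair.Bimodule {𝕜 : Type u} [Field 𝕜] {κ : 𝕜} {A : Type v} [AddCommGroup A]
    [Module 𝕜 A] (P : MRBAssDerPair 𝕜 κ A) (M : Type w) [AddCommGroup M] [Module 𝕜 M] where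
  /-- the left action -/
  l : A →ₗ[𝕜] M →ₗ[𝕜] M
  /-- the right action -/
  r : M →ₗ[𝕜] A →ₗ[𝕜] M
  /-- the operator `R_M` -/
  RM : M →ₗ[𝕜] M
  /-- the operator `d_M` -/
  dM : M →ₗ[𝕜] M
  left_assoc : ∀ (a b : A) (m : M), l (P.μ a b) m = l a (l b m)
  middle_assoc : ∀ (a b : A) (m : M), l a (r m b) = r (l a m) b
  right_assoc : ∀ (a b : A) (m : M), r m (P.μ a b) = r (r m a) b
  left_rotaBaxter : ∀ (a : A) (m : M),
    l (P.R a) (RM m) = RM (l (P.R a) m + l a (RM m)) + κ • l a m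
  right_rotaBaxter : ∀ (a : A) (m : M),
    r (RM m) (P.R a) = RM (r (RM m) a + r m (P.R a)) + κ • r m a
  left_derivation : ∀ (a : A) (m : M), dM (l a m) = l (P.d a) m + l a (dM m)
  right_derivation : ∀ (a : A) (m : M), dM (r m a) = r (dM m) a + r m (P.d a)
  comm : RM ∘ₗ dM = dM ∘ₗ RM

namespace MRBAssDerPair

section Cochains

variable (𝕜 : Type u) [Field 𝕜] (A : Type v) [AddCommGroup A] [Module 𝕜 A]
  (M : Type w) [AddCommGroup M] [Module 𝕜 M]

/-- `C^n(A; M) = Hom(A^{⊗ n}, M)`, as `n`-linear maps. -/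
abbrev Cochain (n : ℕ) : Type (max v w) := MultilinearMap 𝕜 (fun _ : Fin n => A) M

/-- The cochains of a modified Rota-Baxter associative algebra: `C^1(A; M)` in degree `1` and
`C^n(A; M) × C^{n-1}(A; M)` in degree `n ≥ 2`. Nothing lives in degree `0`. -/
abbrev RBCochain : ℕ → Type (max v w)
  | 0 => PUnit.{max v w + 1}
  | 1 => Cochain 𝕜 A M 1
  | n + 2 => Cochain 𝕜 A M (n + 2) × Cochain 𝕜 A M (n + 1)

instance instAddCommGroupRBCochain : ∀ n : ℕ, AddCommGroup (RBCochain 𝕜 A M n)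
  | 0 => inferInstanceAs (AddCommGroup PUnit.{max v w + 1})
  | 1 => inferInstanceAs (AddCommGroup (Cochain 𝕜 A M 1))
  | n + 2 => inferInstanceAs (AddCommGroup (Cochain 𝕜 A M (n + 2) × Cochain 𝕜 A M (n + 1)))

instance instModuleRBCochain : ∀ n : ℕ, Module 𝕜 (RBCochain 𝕜 A M n)
  | 0 => inferInstanceAs (Module 𝕜 PUnit.{max v w + 1})
  | 1 => inferInstanceAs (Module 𝕜 (Cochain 𝕜 A M 1))
  | n + 2 => inferInstanceAs (Module 𝕜 (Cochain 𝕜 A M (n + 2) × Cochain 𝕜 A M (n + 1)))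

/-- The cochains of a modified Rota-Baxter AssDer pair: `C^1(A; M)` in degree `1` and, in degree
`n ≥ 2`, pairs of Rota-Baxter cochains of degrees `n` and `n - 1`. Nothing lives in
degree `0`. -/
abbrev PairCochain : ℕ → Type (max v w)
  | 0 => PUnit.{max v w + 1}
  | 1 => Cochain 𝕜 A M 1
  | n + 2 => RBCochain 𝕜 A M (n + 2) × RBCochain 𝕜 A M (n + 1)

instance instAddCommGroupPairCochain : ∀ n : ℕ, AddCommGroup (PairCochain 𝕜 A M n)
  | 0 => inferInstanceAs (AddCommGroup PUnit.{max v w + 1})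
  | 1 => inferInstanceAs (AddCommGroup (Cochain 𝕜 A M 1))
  | n + 2 => inferInstanceAs (AddCommGroup (RBCochain 𝕜 A M (n + 2) × RBCochain 𝕜 A M (n + 1)))

instance instModulePairCochain : ∀ n : ℕ, Module 𝕜 (PairCochain 𝕜 A M n)
  | 0 => inferInstanceAs (Module 𝕜 PUnit.{max v w + 1})
  | 1 => inferInstanceAs (Module 𝕜 (Cochain 𝕜 A M 1))
  | n + 2 => inferInstanceAs (Module 𝕜 (RBCochain 𝕜 A M (n + 2) × RBCochain 𝕜 A M (n + 1)))

end Cochains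

section Hochschild

variable {𝕜 : Type u} [Field 𝕜] {A : Type v} [AddCommGroup A] [Module 𝕜 A]
  {M : Type w} [AddCommGroup M] [Module 𝕜 M]

/-- Changing one entry of `a` changes one entry of the contracted tuple, linearly. -/
theorem contractNth_update (μ : A →ₗ[𝕜] A →ₗ[𝕜] A) {n : ℕ} (i : Fin n) (a : Fin (n + 1) → A)
    (k : Fin (n + 1)) :
    ∃ (p : Fin n) (L : A →ₗ[𝕜] A), ∀ x : A,
      Fin.contractNth i.castSucc (fun x y => μ x y) (Function.update a k x) =
        Function.update (Fin.contractNth i.castSucc (fun x y => μ x y) a) p (L x) := by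
  rcases lt_trichotomy (k : ℕ) i with h | h | h
  · refine ⟨⟨k, by lia⟩, LinearMap.id, fun x => ?_⟩
    ext j
    simp only [Fin.contractNth, Function.update_apply, Fin.ext_iff, Fin.val_castSucc, Fin.val_succ,
      LinearMap.id_apply]
    split_ifs <;> first | rfl | (exfalso; lia)
  · refine ⟨i, μ.flip (a i.succ), fun x => ?_⟩
    ext j
    by_cases hj : j = i
    · subst hj
      simp [Fin.contractNth, Function.update_apply, Fin.ext_iff, h]
    · simp only [Fin.contractNth, Function.update_apply, Fin.ext_iff, Fin.val_castSucc,
        Fin.val_succ]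
      rw [Fin.ext_iff] at hj
      split_ifs <;> first | rfl | (exfalso; lia)
  · by_cases h' : (k : ℕ) = i + 1
    · refine ⟨i, μ (a i.castSucc), fun x => ?_⟩
      ext j
      by_cases hj : j = i
      · subst hj
        simp [Fin.contractNth, Function.update_apply, Fin.ext_iff, h']
      · simp only [Fin.contractNth, Function.update_apply, Fin.ext_iff, Fin.val_castSucc,
          Fin.val_succ]
        rw [Fin.ext_iff] at hj
        split_ifs <;> first | rfl | (exfalso; lia)
    · refine ⟨⟨k - 1, by lia⟩, LinearMap.id, fun x => ?_⟩
      ext j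
      simp only [Fin.contractNth, Function.update_apply, Fin.ext_iff, Fin.val_castSucc,
        Fin.val_succ, LinearMap.id_apply]
      split_ifs <;> first | rfl | (exfalso; lia)

/-- The `(n + 1)`-linear map `(a_1, …, a_{n+1}) ↦ f(a_1, …, μ(a_i, a_{i+1}), …, a_{n+1})`
(here `i` counts from `0`). -/
def contract (μ : A →ₗ[𝕜] A →ₗ[𝕜] A) {n : ℕ} (i : Fin n) (f : Cochain 𝕜 A M n) :
    Cochain 𝕜 A M (n + 1) :=
  MultilinearMap.mk' (fun a => f (Fin.contractNth i.castSucc (fun x y => μ x y) a))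
    (fun a k x y => by
      obtain ⟨p, L, h⟩ := contractNth_update μ i a k
      simp only [h, map_add, MultilinearMap.map_update_add])
    (fun a k c x => by
      obtain ⟨p, L, h⟩ := contractNth_update μ i a k
      simp only [h, map_smul, MultilinearMap.map_update_smul])

/-- The `(n + 1)`-linear map `(a_1, …, a_{n+1}) ↦ l(a_1, f(a_2, …, a_{n+1}))`. -/
def leftAct (l : A →ₗ[𝕜] M →ₗ[𝕜] M) {n : ℕ} (f : Cochain 𝕜 A M n) : Cochain 𝕜 A M (n + 1) :=
  MultilinearMap.mk' (fun a => l (a 0) (f (Fin.tail a)))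
    (fun a k x y => by
      refine Fin.cases ?_ (fun j => ?_) k
      · simp
      · simp [Fin.tail_update_succ, Function.update_of_ne (Fin.succ_ne_zero j).symm])
    (fun a k c x => by
      refine Fin.cases ?_ (fun j => ?_) k
      · simp
      · simp [Fin.tail_update_succ, Function.update_of_ne (Fin.succ_ne_zero j).symm])

/-- The `(n + 1)`-linear map `(a_1, …, a_{n+1}) ↦ r(f(a_1, …, a_n), a_{n+1})`. -/
def rightAct (r : M →ₗ[𝕜] A →ₗ[𝕜] M) {n : ℕ} (f : Cochain 𝕜 A M n) : Cochain 𝕜 A M (n + 1) :=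
  MultilinearMap.mk' (fun a => r (f (Fin.init a)) (a (Fin.last n)))
    (fun a k x y => by
      refine Fin.lastCases ?_ (fun j => ?_) k
      · simp
      · simp [Fin.init_update_castSucc, (Fin.castSucc_lt_last j).ne'])
    (fun a k c x => by
      refine Fin.lastCases ?_ (fun j => ?_) k
      · simp
      · simp [Fin.init_update_castSucc, (Fin.castSucc_lt_last j).ne'])

/-- The Hochschild differential of the product `μ` and the actions `l`, `r`:
`(δf)(a_1, …, a_{n+1}) = (-1)^{n+1} l(a_1, f(a_2, …, a_{n+1})) + r(f(a_1, …, a_n), a_{n+1})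
  + ∑_{i=1}^{n} (-1)^{i+n+1} f(a_1, …, μ(a_i, a_{i+1}), …, a_{n+1})`. -/
def hochschild (μ : A →ₗ[𝕜] A →ₗ[𝕜] A) (l : A →ₗ[𝕜] M →ₗ[𝕜] M) (r : M →ₗ[𝕜] A →ₗ[𝕜] M) (n : ℕ) :
    Cochain 𝕜 A M n →ₗ[𝕜] Cochain 𝕜 A M (n + 1) where
  toFun f := (-1 : 𝕜) ^ (n + 1) • leftAct l f + rightAct r f +
    ∑ i : Fin n, (-1 : 𝕜) ^ ((i : ℕ) + 1 + n + 1) • contract μ i f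
  map_add' f g := by
    ext a
    simp [leftAct, rightAct, contract, Finset.sum_add_distrib]
    abel
  map_smul' c f := by
    ext a
    simp [leftAct, rightAct, contract, Finset.smul_sum, smul_comm c]

end Hochschild

section Complex

variable {𝕜 : Type u} [Field 𝕜] {κ : 𝕜} {A : Type v} [AddCommGroup A] [Module 𝕜 A]
  {M : Type w} [AddCommGroup M] [Module 𝕜 M]

/-- The induced product `μ_R(a, b) = μ(R a, b) + μ(a, R b)`. -/
def inducedMul (P : MRBAssDerPair 𝕜 κ A) : A →ₗ[𝕜] A →ₗ[𝕜] A :=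
  P.μ ∘ₗ P.R + P.μ.compl₂ P.R

variable {P : MRBAssDerPair 𝕜 κ A}

/-- The induced left action `l̃(a, m) = l(R a, m) - R_M(l(a, m))`. -/
def Bimodule.inducedLeft (B : P.Bimodule M) : A →ₗ[𝕜] M →ₗ[𝕜] M :=
  B.l ∘ₗ P.R - B.l.compr₂ B.RM

/-- The induced right action `r̃(m, a) = r(m, R a) - R_M(r(m, a))`. -/
def Bimodule.inducedRight (B : P.Bimodule M) : M →ₗ[𝕜] A →ₗ[𝕜] M :=
  B.r.compl₂ P.R - B.r.compr₂ B.RM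

/-- `δ_Hoch`: the Hochschild differential of `A` with coefficients in `M`. -/
def Bimodule.deltaHoch (B : P.Bimodule M) (n : ℕ) : Cochain 𝕜 A M n →ₗ[𝕜] Cochain 𝕜 A M (n + 1) :=
  hochschild P.μ B.l B.r n

/-- `δ_mHoch`: the Hochschild differential of the induced algebra `A_R` with coefficients in the
induced bimodule. -/
def Bimodule.deltaMHoch (B : P.Bimodule M) (n : ℕ) :
    Cochain 𝕜 A M n →ₗ[𝕜] Cochain 𝕜 A M (n + 1) :=
  hochschild P.inducedMul B.inducedLeft B.inducedRight n

/-- `f ↦ f(b_1, …, b_n)` with `b_j = a_j` for `j ∈ S` and `b_j = R(a_j)` for `j ∉ S`. -/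
def mixed (P : MRBAssDerPair 𝕜 κ A) {n : ℕ} (S : Finset (Fin n)) :
    Cochain 𝕜 A M n →ₗ[𝕜] Cochain 𝕜 A M n :=
  MultilinearMap.compLinearMapₗ (fun j => if j ∈ S then LinearMap.id else P.R)

/-- `φ^n(f)(a_1, …, a_n) = f(R a_1, …, R a_n) - ∑_{|S| odd} (-κ)^{(|S|-1)/2} R_M(f(b^S))
  + ∑_{|S| ≥ 2 even} (-κ)^{|S|/2} f(b^S)`, where `S = {i_1 < ⋯ < i_r} ⊆ {1, …, n}` and `b^S` is
`(R a_1, …, R a_n)` with `R` removed at the places in `S`. -/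
def Bimodule.phi (B : P.Bimodule M) (n : ℕ) : Cochain 𝕜 A M n →ₗ[𝕜] Cochain 𝕜 A M n :=
  P.mixed ∅
    - ∑ S : Finset (Fin n) with Odd S.card,
        (-κ) ^ ((S.card - 1) / 2) • (LinearMap.compMultilinearMapₗ 𝕜 B.RM ∘ₗ P.mixed S)
    + ∑ S : Finset (Fin n) with S.Nonempty ∧ Even S.card, (-κ) ^ (S.card / 2) • P.mixed S

/-- `Δ^n(f) = ∑_i f ∘ (id ⊗ ⋯ ⊗ d ⊗ ⋯ ⊗ id) - d_M ∘ f`. -/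
def Bimodule.Delta (B : P.Bimodule M) (n : ℕ) : Cochain 𝕜 A M n →ₗ[𝕜] Cochain 𝕜 A M n :=
  ∑ i : Fin n, MultilinearMap.compLinearMapₗ (fun j => if j = i then P.d else LinearMap.id)
    - LinearMap.compMultilinearMapₗ 𝕜 B.dM

/-- `∂^1(f) = (δ_Hoch f, -φ^1 f)`, and
`∂^n(f, g) = (δ_Hoch f, -δ_mHoch g - φ^n f)` for `n ≥ 2`. -/
def Bimodule.partialRB (B : P.Bimodule M) :
    ∀ n : ℕ, RBCochain 𝕜 A M n →ₗ[𝕜] RBCochain 𝕜 A M (n + 1)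
  | 0 => 0
  | 1 => LinearMap.prod (B.deltaHoch 1) (-B.phi 1)
  | n + 2 => LinearMap.prod (B.deltaHoch (n + 2) ∘ₗ LinearMap.fst 𝕜 _ _)
      (-(B.deltaMHoch (n + 1) ∘ₗ LinearMap.snd 𝕜 _ _) - B.phi (n + 2) ∘ₗ LinearMap.fst 𝕜 _ _)

/-- `Δ^n(f, g) = (Δ^n f, Δ^{n-1} g)` on Rota-Baxter cochains (`Δ^1 f` in degree `1`). -/
def Bimodule.DeltaRB (B : P.Bimodule M) :
    ∀ n : ℕ, RBCochain 𝕜 A M n →ₗ[𝕜] RBCochain 𝕜 A M n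
  | 0 => 0
  | 1 => B.Delta 1
  | n + 2 => LinearMap.prodMap (B.Delta (n + 2)) (B.Delta (n + 1))

/-- `𝔇^1(f) = (∂^1 f, -Δ^1 f)`, and
`𝔇^n(F, G) = (∂^n F, ∂^{n-1} G + (-1)^n Δ^n F)` for `n ≥ 2`. -/
def Bimodule.pairDifferential (B : P.Bimodule M) :
    ∀ n : ℕ, PairCochain 𝕜 A M n →ₗ[𝕜] PairCochain 𝕜 A M (n + 1)
  | 0 => 0
  | 1 => LinearMap.prod (B.partialRB 1) (-B.DeltaRB 1)
  | n + 2 => LinearMap.prod (B.partialRB (n + 2) ∘ₗ LinearMap.fst 𝕜 _ _)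
      (B.partialRB (n + 1) ∘ₗ LinearMap.snd 𝕜 _ _
        + (-1 : 𝕜) ^ (n + 2) • B.DeltaRB (n + 2) ∘ₗ LinearMap.fst 𝕜 _ _)

end Complex

end MRBAssDerPair

/-! The complex is an iterated mapping cone. It suffices that `δ_Hoch` and `δ_mHoch` square to zero,
that `φ` intertwines them, and that `Δ` commutes with `δ_Hoch`, `δ_mHoch` and `φ`; the signs then
cancel the mixed terms, first in `∂`, then in `𝔇`.

The relation δ² = 0 is proved by dimension shifting: moving the first argument of a cochain into the
coefficients turns the differential with values in `M` into the one with values in the bimodule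
Hom(A, M), so everything reduces to δ¹δ⁰ = 0 (`hochschild_hochschild`). It applies to `δ_mHoch`
because the modified Rota-Baxter identities make `μ_R`, `l̃`, `r̃` again an associative product and
a bimodule.

For `φ`, write φ = E - R_M ∘ O, where E and O are sums over all subsets, weighted by coefficients
with o(k+1) = e(k) and e(k+1) = -κ o(k). Fixing one argument gives a two-term recursion for such
sums, and `phi_deltaHoch` follows term by term in the Hochschild formula. The statements on `Δ`
express the Leibniz rule and commutation with `R` and `R_M`. -/

namespace MRBAssDerPair

/-! ### Cochains with the first argument fixed -/

section Slices

variable {𝕜 : Type u} [Field 𝕜] {A : Type v} [AddCommGroup A] [Module 𝕜 A]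
  {M : Type w} [AddCommGroup M] [Module 𝕜 M] {N : Type*} [AddCommGroup N] [Module 𝕜 N]

/-- Fixing the first argument of a cochain. -/
def slice {n : ℕ} : A →ₗ[𝕜] Cochain 𝕜 A M (n + 1) →ₗ[𝕜] Cochain 𝕜 A M n :=
  (multilinearCurryLeftEquiv 𝕜 (fun _ : Fin (n + 1) => A) M).toLinearMap.flip

@[simp] theorem slice_apply {n : ℕ} (x : A) (f : Cochain 𝕜 A M (n + 1)) (a : Fin n → A) :
    slice x f a = f (Fin.cons x a) := rfl

theorem ext_slice {n : ℕ} {f g : Cochain 𝕜 A M (n + 1)} (h : ∀ x, slice x f = slice x g) :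
    f = g := by
  ext a
  have := congrArg (fun k => k (Fin.tail a)) (h (a 0))
  simpa using this

@[simp] theorem contract_apply (μ : A →ₗ[𝕜] A →ₗ[𝕜] A) {n : ℕ} (i : Fin n) (f : Cochain 𝕜 A M n)
    (a : Fin (n + 1) → A) :
    contract μ i f a = f (Fin.contractNth i.castSucc (fun x y => μ x y) a) := rfl

@[simp] theorem leftAct_apply (l : A →ₗ[𝕜] M →ₗ[𝕜] M) {n : ℕ} (f : Cochain 𝕜 A M n)
    (a : Fin (n + 1) → A) : leftAct l f a = l (a 0) (f (Fin.tail a)) := rfl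

@[simp] theorem rightAct_apply (r : M →ₗ[𝕜] A →ₗ[𝕜] M) {n : ℕ} (f : Cochain 𝕜 A M n)
    (a : Fin (n + 1) → A) : rightAct r f a = r (f (Fin.init a)) (a (Fin.last n)) := rfl

theorem slice_comp {n : ℕ} (x : A) (g : M →ₗ[𝕜] N) (f : Cochain 𝕜 A M (n + 1)) :
    slice x (g.compMultilinearMap f : Cochain 𝕜 A N (n + 1)) =
      g.compMultilinearMap (slice x f) := rfl

theorem slice_contract_succ (μ : A →ₗ[𝕜] A →ₗ[𝕜] A) {n : ℕ} (i : Fin n) (x : A)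
    (f : Cochain 𝕜 A M (n + 1)) : slice x (contract μ i.succ f) = contract μ i (slice x f) := by
  ext a
  simp only [slice_apply, contract_apply]
  congr 1
  ext j
  refine Fin.cases ?_ (fun j => ?_) j
  · simp [Fin.contractNth]
  · simp [Fin.contractNth]

theorem slice_slice_contract_zero (μ : A →ₗ[𝕜] A →ₗ[𝕜] A) {n : ℕ} (x y : A)
    (f : Cochain 𝕜 A M (n + 1)) : slice y (slice x (contract μ 0 f)) = slice (μ x y) f := by
  ext a
  simp only [slice_apply, contract_apply]
  congr 1
  ext j
  refine Fin.cases ?_ (fun j => ?_) j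
  · simp [Fin.contractNth]
  · simp [Fin.contractNth]

theorem slice_leftAct (l : A →ₗ[𝕜] M →ₗ[𝕜] M) {n : ℕ} (x : A) (f : Cochain 𝕜 A M n) :
    slice x (leftAct l f) = (l x).compMultilinearMap f := by
  ext a
  simp

theorem slice_rightAct (r : M →ₗ[𝕜] A →ₗ[𝕜] M) {n : ℕ} (x : A) (f : Cochain 𝕜 A M (n + 1)) :
    slice x (rightAct r f) = rightAct r (slice x f) := by
  ext a
  simp only [slice_apply, rightAct_apply]
  rw [← Fin.succ_last, Fin.cons_succ]
  congr 3
  ext j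
  refine Fin.cases ?_ (fun j => ?_) j <;> simp [Fin.init]

theorem slice_rightAct_zero (r : M →ₗ[𝕜] A →ₗ[𝕜] M) (x : A) (f : Cochain 𝕜 A M 0) :
    slice x (rightAct r f) = (r.flip x).compMultilinearMap f := by
  ext a
  simp only [slice_apply, rightAct_apply, LinearMap.compMultilinearMap_apply, LinearMap.flip_apply]
  congr 2
  exact congrArg f (Subsingleton.elim _ _)

/-! ### Weighted sums over subsets of arguments -/

/-- The sum over all `S` of `c |S| • f(b^S)`, where `b^S` applies `R` at the places outside `S`. -/
def mixedSum (R : A →ₗ[𝕜] A) (c : ℕ → 𝕜) (n : ℕ) : Cochain 𝕜 A M n →ₗ[𝕜] Cochain 𝕜 A M n :=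
  ∑ S : Finset (Fin n), c S.card •
    MultilinearMap.compLinearMapₗ (fun j => if j ∈ S then LinearMap.id else R)

theorem mixedSum_apply (R : A →ₗ[𝕜] A) (c : ℕ → 𝕜) {n : ℕ} (f : Cochain 𝕜 A M n) (a : Fin n → A) :
    mixedSum R c n f a =
      ∑ S : Finset (Fin n), c S.card • f (fun j => if j ∈ S then a j else R (a j)) := by
  simp only [mixedSum, LinearMap.sum_apply, LinearMap.smul_apply, sum_apply, smul_apply,
    MultilinearMap.compLinearMapₗ_apply,
    MultilinearMap.compLinearMap_apply]
  refine Finset.sum_congr rfl fun S _ => ?_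
  congr 2
  ext j
  split_ifs <;> rfl

theorem zero_notMem_map_succ {n : ℕ} (S : Finset (Fin n)) : 0 ∉ S.map (Fin.succEmb n) := by
  simp [Fin.succ_ne_zero]

theorem card_insert_zero_map_succ {n : ℕ} (S : Finset (Fin n)) :
    (insert 0 (S.map (Fin.succEmb n))).card = S.card + 1 := by
  rw [Finset.card_insert_of_notMem (zero_notMem_map_succ S), Finset.card_map]

theorem sum_finset_fin_succ {n : ℕ} (F : Finset (Fin (n + 1)) → M) :
    ∑ S, F S = ∑ S : Finset (Fin n), F (S.map (Fin.succEmb n)) +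
      ∑ S : Finset (Fin n), F (insert 0 (S.map (Fin.succEmb n))) := by
  have key (G : Finset (Fin (n + 1)) → M) :
      ∑ S ∈ (Finset.univ.map (Fin.succEmb n)).powerset, G S =
        ∑ S : Finset (Fin n), G (S.map (Fin.succEmb n)) := by
    refine (Finset.sum_bij (fun S _ => S.map (Fin.succEmb n)) ?_ ?_ ?_ ?_).symm
    · intro S _
      exact Finset.mem_powerset.2 (Finset.map_subset_map.2 (Finset.subset_univ S))
    · intro S _ T _ h
      exact Finset.map_injective _ h
    · intro S hS
      obtain ⟨T, -, rfl⟩ := Finset.subset_map_iff.1 (Finset.mem_powerset.1 hS)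
      exact ⟨T, Finset.mem_univ _, rfl⟩
    · intro S _
      rfl
  have huniv : (Finset.univ : Finset (Fin (n + 1))) =
      insert 0 (Finset.univ.map (Fin.succEmb n)) := by
    ext j
    refine Fin.cases ?_ (fun j => ?_) j <;> simp
  rw [← Finset.powerset_univ, huniv, Finset.sum_powerset_insert (zero_notMem_map_succ _), key, key]

/-- Subsets are split by whether they contain the first place: if not, `x` is fed through `R`; if
so, `x` stays and the size, hence the index of `c`, goes up by one. All later inductions run on this
recursion. -/
theorem slice_mixedSum (R : A →ₗ[𝕜] A) (c : ℕ → 𝕜) {n : ℕ} (x : A) (f : Cochain 𝕜 A M (n + 1)) :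
    slice x (mixedSum R c (n + 1) f) =
      mixedSum R c n (slice (R x) f) + mixedSum R (fun k => c (k + 1)) n (slice x f) := by
  ext a
  simp only [slice_apply, add_apply, mixedSum_apply]
  rw [sum_finset_fin_succ]
  congr 1
  all_goals
    refine Finset.sum_congr rfl fun S _ => ?_
    simp only [Finset.card_map, card_insert_zero_map_succ]
    congr 2
    ext j
    refine Fin.cases ?_ (fun j => ?_) j <;> simp [Fin.succ_ne_zero]

theorem mixedSum_smul_coeff (R : A →ₗ[𝕜] A) (c : ℕ → 𝕜) (t : 𝕜) {n : ℕ} (f : Cochain 𝕜 A M n) :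
    mixedSum R (fun k => t * c k) n f = t • mixedSum R c n f := by
  ext a
  simp [mixedSum_apply, Finset.smul_sum, mul_smul]

theorem mixedSum_comp (R : A →ₗ[𝕜] A) (c : ℕ → 𝕜) {n : ℕ} (g : M →ₗ[𝕜] N)
    (f : Cochain 𝕜 A M n) :
    mixedSum R c n (g.compMultilinearMap f : Cochain 𝕜 A N n) =
      g.compMultilinearMap (mixedSum R c n f) := by
  ext a
  simp [mixedSum_apply]

/-- Only the two arguments being multiplied matter. Their four choices give μ(Rx, Ry) with weights
c(k), μ_R(x, y) with c(k+1), and μ(x, y) with c(k+2) = t c(k). The last cancels the `t`-term of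
`hR`, leaving R(μ_R(x, y)) and μ_R(x, y), the two choices for a single argument. -/
theorem mixedSum_contract (μ μR : A →ₗ[𝕜] A →ₗ[𝕜] A) (R : A →ₗ[𝕜] A) (t : 𝕜)
    (hμ : ∀ a b, μR a b = μ (R a) b + μ a (R b))
    (hR : ∀ a b, μ (R a) (R b) = R (μR a b) - t • μ a b) :
    ∀ {n : ℕ} (c : ℕ → 𝕜) (_ : ∀ k, c (k + 2) = t * c k) (i : Fin n) (f : Cochain 𝕜 A M n),
      mixedSum R c (n + 1) (contract μ i f) = contract μR i (mixedSum R c n f) := by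
  intro n
  induction n with
  | zero => intro c _ i; exact i.elim0
  | succ n ih =>
    intro c hc i f
    refine ext_slice fun x => ?_
    refine Fin.cases ?_ (fun i => ?_) i
    · refine ext_slice fun y => ?_
      simp only [slice_slice_contract_zero, slice_mixedSum, map_add, hμ, hR, LinearMap.add_apply,
        map_sub, LinearMap.sub_apply, map_smul, LinearMap.smul_apply, hc, mixedSum_smul_coeff]
      abel
    · have h := ih (fun k => c (k + 1)) fun k => hc (k + 1)
      simp only [slice_contract_succ, slice_mixedSum, ih c hc, h]
      ext a
      simp

theorem mixedSum_leftAct (l : A →ₗ[𝕜] M →ₗ[𝕜] M) (R : A →ₗ[𝕜] A) {n : ℕ} (c : ℕ → 𝕜)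
    (f : Cochain 𝕜 A M n) :
    mixedSum R c (n + 1) (leftAct l f) = leftAct (l ∘ₗ R) (mixedSum R c n f) +
      leftAct l (mixedSum R (fun k => c (k + 1)) n f) := by
  refine ext_slice fun x => ?_
  simp only [slice_mixedSum, slice_leftAct, map_add, mixedSum_comp, LinearMap.comp_apply]

/-- Unlike the left action, the right one uses the last argument, which slicing from the front
reaches only when `n = 0`; hence the induction. -/
theorem mixedSum_rightAct (r : M →ₗ[𝕜] A →ₗ[𝕜] M) (R : A →ₗ[𝕜] A) : ∀ {n : ℕ} (c : ℕ → 𝕜)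
    (f : Cochain 𝕜 A M n),
    mixedSum R c (n + 1) (rightAct r f) = rightAct (r.compl₂ R) (mixedSum R c n f) +
      rightAct r (mixedSum R (fun k => c (k + 1)) n f) := by
  intro n
  induction n with
  | zero =>
    intro c f
    refine ext_slice fun x => ?_
    simp only [slice_mixedSum, slice_rightAct_zero, map_add, mixedSum_comp]
    ext a
    simp
  | succ n ih =>
    intro c f
    refine ext_slice fun x => ?_
    simp only [slice_mixedSum, slice_rightAct, map_add, ih]
    ext a
    simp only [add_apply, rightAct_apply, LinearMap.map_add, LinearMap.add_apply]
    abel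

/-! ### The derivation acting on arguments -/

/-- The sum over all places `i` of `f` with `d` applied at the place `i`. -/
def derivSum (d : A →ₗ[𝕜] A) (n : ℕ) : Cochain 𝕜 A M n →ₗ[𝕜] Cochain 𝕜 A M n :=
  ∑ i : Fin n, MultilinearMap.compLinearMapₗ (fun j => if j = i then d else LinearMap.id)

theorem derivSum_apply (d : A →ₗ[𝕜] A) {n : ℕ} (f : Cochain 𝕜 A M n) (a : Fin n → A) :
    derivSum d n f a = ∑ i, f (fun j => if j = i then d (a j) else a j) := by
  simp only [derivSum, LinearMap.sum_apply, sum_apply,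
    MultilinearMap.compLinearMapₗ_apply, MultilinearMap.compLinearMap_apply]
  refine Finset.sum_congr rfl fun S _ => ?_
  congr 1
  ext j
  split_ifs <;> rfl

theorem derivSum_zero (d : A →ₗ[𝕜] A) (f : Cochain 𝕜 A M 0) : derivSum d 0 f = 0 := by
  simp [derivSum]

theorem slice_derivSum (d : A →ₗ[𝕜] A) {n : ℕ} (x : A) (f : Cochain 𝕜 A M (n + 1)) :
    slice x (derivSum d (n + 1) f) = slice (d x) f + derivSum d n (slice x f) := by
  ext a
  simp only [slice_apply, add_apply, derivSum_apply, Fin.sum_univ_succ]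
  congr 1
  · congr 1
    ext j
    refine Fin.cases ?_ (fun j => ?_) j <;> simp [Fin.succ_ne_zero]
  · refine Finset.sum_congr rfl fun i _ => ?_
    congr 1
    ext j
    refine Fin.cases ?_ (fun j => ?_) j <;> simp [(Fin.succ_ne_zero _).symm]

theorem derivSum_comp (d : A →ₗ[𝕜] A) {n : ℕ} (g : M →ₗ[𝕜] N) (f : Cochain 𝕜 A M n) :
    derivSum d n (g.compMultilinearMap f : Cochain 𝕜 A N n) =
      g.compMultilinearMap (derivSum d n f) := by
  ext a
  simp [derivSum_apply]

theorem derivSum_mixedSum (R d : A →ₗ[𝕜] A) (h : R ∘ₗ d = d ∘ₗ R) : ∀ {n : ℕ} (c : ℕ → 𝕜)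
    (f : Cochain 𝕜 A M n),
    derivSum d n (mixedSum R c n f) = mixedSum R c n (derivSum d n f) := by
  intro n
  induction n with
  | zero => intro c f; simp [derivSum_zero]
  | succ n ih =>
    intro c f
    refine ext_slice fun x => ?_
    have hx : R (d x) = d (R x) := LinearMap.congr_fun h x
    simp only [slice_derivSum, slice_mixedSum, map_add, ih, hx]
    abel

theorem derivSum_contract (μ : A →ₗ[𝕜] A →ₗ[𝕜] A) (d : A →ₗ[𝕜] A)
    (hd : ∀ a b, d (μ a b) = μ (d a) b + μ a (d b)) :
    ∀ {n : ℕ} (i : Fin n) (f : Cochain 𝕜 A M n),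
      derivSum d (n + 1) (contract μ i f) = contract μ i (derivSum d n f) := by
  intro n
  induction n with
  | zero => intro i; exact i.elim0
  | succ n ih =>
    intro i f
    refine ext_slice fun x => ?_
    refine Fin.cases ?_ (fun i => ?_) i
    · refine ext_slice fun y => ?_
      simp only [slice_slice_contract_zero, slice_derivSum, map_add, hd, LinearMap.add_apply]
      abel
    · simp only [slice_contract_succ, slice_derivSum, ih]
      ext a
      simp

theorem derivSum_leftAct (l : A →ₗ[𝕜] M →ₗ[𝕜] M) (d : A →ₗ[𝕜] A) {n : ℕ}
    (f : Cochain 𝕜 A M n) :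
    derivSum d (n + 1) (leftAct l f) = leftAct (l ∘ₗ d) f + leftAct l (derivSum d n f) := by
  refine ext_slice fun x => ?_
  simp only [slice_derivSum, slice_leftAct, map_add, derivSum_comp, LinearMap.comp_apply]

theorem derivSum_rightAct (r : M →ₗ[𝕜] A →ₗ[𝕜] M) (d : A →ₗ[𝕜] A) : ∀ {n : ℕ}
    (f : Cochain 𝕜 A M n),
    derivSum d (n + 1) (rightAct r f) =
      rightAct (r.compl₂ d) f + rightAct r (derivSum d n f) := by
  intro n
  induction n with
  | zero =>
    intro f
    refine ext_slice fun x => ?_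
    simp only [slice_derivSum, slice_rightAct_zero, map_add, derivSum_zero]
    ext a
    simp
  | succ n ih =>
    intro f
    refine ext_slice fun x => ?_
    simp only [slice_derivSum, slice_rightAct, map_add, ih]
    ext a
    simp only [add_apply, rightAct_apply, LinearMap.map_add, LinearMap.add_apply]
    abel

end Slices

/-! ### The Hochschild differential squares to zero -/

section HochschildSquare

variable {𝕜 : Type u} [Field 𝕜] {A : Type v} [AddCommGroup A] [Module 𝕜 A]
  {M : Type w} [AddCommGroup M] [Module 𝕜 M]

theorem hochschild_apply (μ : A →ₗ[𝕜] A →ₗ[𝕜] A) (l : A →ₗ[𝕜] M →ₗ[𝕜] M) (r : M →ₗ[𝕜] A →ₗ[𝕜] M)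
    {n : ℕ} (f : Cochain 𝕜 A M n) :
    hochschild μ l r n f = (-1 : 𝕜) ^ (n + 1) • leftAct l f + rightAct r f +
      ∑ i : Fin n, (-1 : 𝕜) ^ ((i : ℕ) + 1 + n + 1) • contract μ i f := rfl

/-- The first argument of a cochain moved into the coefficients. -/
def shift {n : ℕ} (f : Cochain 𝕜 A M (n + 1)) : Cochain 𝕜 A (A →ₗ[𝕜] M) n :=
  MultilinearMap.mk'
    (fun a =>
      { toFun := fun x => slice x f a
        map_add' := fun x y => by simp only [map_add, LinearMap.add_apply, add_apply]
        map_smul' := fun t x => by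
          simp only [map_smul, LinearMap.smul_apply, smul_apply, RingHom.id_apply] })
    (fun a k x y => by
      ext z
      exact (slice z f).map_update_add a k x y)
    (fun a k t x => by
      ext z
      exact (slice z f).map_update_smul a k t x)

theorem shift_apply {n : ℕ} (f : Cochain 𝕜 A M (n + 1)) (a : Fin n → A) (x : A) :
    shift f a x = slice x f a := rfl

theorem ext_shift {n : ℕ} {f g : Cochain 𝕜 A M (n + 1)} (h : shift f = shift g) : f = g := by
  refine ext_slice fun x => ?_
  ext a
  rw [← shift_apply, h, shift_apply]

/-- The left action on `Hom(A, M)`: `(a g)(x) = g(x a) - x g(a)`. -/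
def shiftLeft (μ : A →ₗ[𝕜] A →ₗ[𝕜] A) (l : A →ₗ[𝕜] M →ₗ[𝕜] M) :
    A →ₗ[𝕜] (A →ₗ[𝕜] M) →ₗ[𝕜] (A →ₗ[𝕜] M) :=
  LinearMap.mk₂ 𝕜 (fun a g => g ∘ₗ μ.flip a - l.flip (g a))
    (fun a b g => by ext x; simp; abel) (fun t a g => by ext x; simp [smul_sub])
    (fun a g h => by ext x; simp; abel) (fun t a g => by ext x; simp [smul_sub])

theorem shiftLeft_apply (μ : A →ₗ[𝕜] A →ₗ[𝕜] A) (l : A →ₗ[𝕜] M →ₗ[𝕜] M) (a : A) (g : A →ₗ[𝕜] M)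
    (x : A) : shiftLeft μ l a g x = g (μ x a) - l x (g a) := rfl

/-- The right action on `Hom(A, M)`: `(g a)(x) = g(x) a`. -/
def shiftRight (r : M →ₗ[𝕜] A →ₗ[𝕜] M) : (A →ₗ[𝕜] M) →ₗ[𝕜] A →ₗ[𝕜] (A →ₗ[𝕜] M) :=
  LinearMap.mk₂ 𝕜 (fun g a => r.flip a ∘ₗ g)
    (fun g h a => by ext x; simp) (fun t g a => by ext x; simp)
    (fun g a b => by ext x; simp) (fun t g a => by ext x; simp)

theorem shiftRight_apply (r : M →ₗ[𝕜] A →ₗ[𝕜] M) (a : A) (g : A →ₗ[𝕜] M) (x : A) :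
    shiftRight r g a x = r (g x) a := rfl

/-- The outer left action and the first contraction, which carry opposite signs, together form the
left action on Hom(A, M); the remaining contractions move down one index. -/
theorem shift_hochschild (μ : A →ₗ[𝕜] A →ₗ[𝕜] A) (l : A →ₗ[𝕜] M →ₗ[𝕜] M) (r : M →ₗ[𝕜] A →ₗ[𝕜] M)
    {n : ℕ} (f : Cochain 𝕜 A M (n + 1)) :
    shift (hochschild μ l r (n + 1) f) =
      hochschild μ (shiftLeft μ l) (shiftRight r) n (shift f) := by
  ext a x
  have h0 : slice x (contract μ 0 f) a = f (Fin.cons (μ x (a 0)) (Fin.tail a)) := by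
    have := congrArg (fun k => k (Fin.tail a)) (slice_slice_contract_zero μ x (a 0) f)
    simpa using this
  have hl : slice x (leftAct l f) a = l x (f (Fin.cons (a 0) (Fin.tail a))) := by
    simp [slice_leftAct]
  simp only [shift_apply, hochschild_apply, map_add, map_smul, map_sum, Fin.sum_univ_succ,
    slice_contract_succ, slice_rightAct, add_apply, smul_apply, sum_apply, h0, hl,
    LinearMap.add_apply, LinearMap.smul_apply, LinearMap.sum_apply, leftAct_apply, rightAct_apply,
    contract_apply, shiftLeft_apply, shiftRight_apply, slice_apply]
  -- Index and degree both drop by one, so the exponent changes by two and the sign survives.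
  have e (i : Fin n) :
      (-1 : 𝕜) ^ ((i.succ : ℕ) + 1 + (n + 1) + 1) = (-1) ^ ((i : ℕ) + 1 + n + 1) := by
    rw [Fin.val_succ, show (i : ℕ) + 1 + 1 + (n + 1) + 1 = (i : ℕ) + 1 + n + 1 + 2 by ring, pow_add]
    simp
  simp only [e, Fin.val_zero]
  rw [show 0 + 1 + (n + 1) + 1 = n + 1 + 2 by ring, pow_add _ (n + 1) 2, pow_succ _ (n + 1)]
  module

theorem shiftLeft_mul {μ : A →ₗ[𝕜] A →ₗ[𝕜] A} {l : A →ₗ[𝕜] M →ₗ[𝕜] M}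
    (hμ : ∀ a b c, μ (μ a b) c = μ a (μ b c)) (hl : ∀ a b m, l (μ a b) m = l a (l b m))
    (a b : A) (g : A →ₗ[𝕜] M) :
    shiftLeft μ l (μ a b) g = shiftLeft μ l a (shiftLeft μ l b g) := by
  ext x
  simp only [shiftLeft_apply, hl, hμ, map_sub]
  abel

theorem shiftLeft_shiftRight {μ : A →ₗ[𝕜] A →ₗ[𝕜] A} {l : A →ₗ[𝕜] M →ₗ[𝕜] M}
    {r : M →ₗ[𝕜] A →ₗ[𝕜] M} (hm : ∀ a b m, l a (r m b) = r (l a m) b) (a b : A) (g : A →ₗ[𝕜] M) :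
    shiftLeft μ l a (shiftRight r g b) = shiftRight r (shiftLeft μ l a g) b := by
  ext x
  simp only [shiftLeft_apply, shiftRight_apply, hm, map_sub, LinearMap.sub_apply]

theorem shiftRight_mul {μ : A →ₗ[𝕜] A →ₗ[𝕜] A} {r : M →ₗ[𝕜] A →ₗ[𝕜] M}
    (hr : ∀ a b m, r m (μ a b) = r (r m a) b) (a b : A) (g : A →ₗ[𝕜] M) :
    shiftRight r g (μ a b) = shiftRight r (shiftRight r g a) b := by
  ext x
  simp only [shiftRight_apply, hr]

/-- The induction replaces `M` by Hom(A, M), so `M` must vary and its universe must absorb that of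
`A`. -/
theorem hochschild_hochschild_aux (μ : A →ₗ[𝕜] A →ₗ[𝕜] A)
    (hμ : ∀ a b c, μ (μ a b) c = μ a (μ b c)) (n : ℕ) :
    ∀ {M : Type (max v w)} [AddCommGroup M] [Module 𝕜 M] (l : A →ₗ[𝕜] M →ₗ[𝕜] M)
      (r : M →ₗ[𝕜] A →ₗ[𝕜] M) (_ : ∀ a b m, l (μ a b) m = l a (l b m))
      (_ : ∀ a b m, l a (r m b) = r (l a m) b) (_ : ∀ a b m, r m (μ a b) = r (r m a) b)
      (f : Cochain 𝕜 A M n), hochschild μ l r (n + 1) (hochschild μ l r n f) = 0 := by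
  induction n with
  | zero =>
    intro M _ _ l r hl hm hr f
    refine ext_slice fun x => ext_slice fun y => ?_
    simp only [hochschild_apply, map_add, map_smul, slice_slice_contract_zero,
      slice_rightAct, slice_rightAct_zero, slice_leftAct, Fin.sum_univ_succ, Fin.sum_univ_zero,
      slice_comp]
    ext a
    simp [hl, hm, hr]
    module
  | succ n ih =>
    intro M _ _ l r hl hm hr f
    apply ext_shift
    rw [shift_hochschild, shift_hochschild, ih _ _ (shiftLeft_mul hμ hl) (shiftLeft_shiftRight hm)
      (shiftRight_mul hr)]
    rfl

theorem hochschild_hochschild {μ : A →ₗ[𝕜] A →ₗ[𝕜] A} {l : A →ₗ[𝕜] M →ₗ[𝕜] M}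
    {r : M →ₗ[𝕜] A →ₗ[𝕜] M} (hμ : ∀ a b c, μ (μ a b) c = μ a (μ b c))
    (hl : ∀ a b m, l (μ a b) m = l a (l b m)) (hm : ∀ a b m, l a (r m b) = r (l a m) b)
    (hr : ∀ a b m, r m (μ a b) = r (r m a) b) {n : ℕ} (f : Cochain 𝕜 A M (n + 1)) :
    hochschild μ l r (n + 2) (hochschild μ l r (n + 1) f) = 0 := by
  -- One shift moves the coefficients from `Type w` into `Type (max v w)`, where the induction
  -- applies.
  apply ext_shift
  rw [shift_hochschild, shift_hochschild, hochschild_hochschild_aux.{u, v, w} μ hμ n _ _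
    (shiftLeft_mul hμ hl) (shiftLeft_shiftRight hm) (shiftRight_mul hr)]
  rfl

end HochschildSquare

/-! ### Recursion for the coefficients of φ -/

section Coefficients

variable {𝕜 : Type u} [Field 𝕜]

/-- The coefficient of the even part of `φ`. -/
def evenCoeff (κ : 𝕜) (k : ℕ) : 𝕜 := if Even k then (-κ) ^ (k / 2) else 0

/-- The coefficient of the odd part of `φ`. -/
def oddCoeff (κ : 𝕜) (k : ℕ) : 𝕜 := if Odd k then (-κ) ^ ((k - 1) / 2) else 0

theorem oddCoeff_succ (κ : 𝕜) (k : ℕ) : oddCoeff κ (k + 1) = evenCoeff κ k := by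
  simp [oddCoeff, evenCoeff, Nat.odd_add_one]

theorem evenCoeff_succ (κ : 𝕜) (k : ℕ) : evenCoeff κ (k + 1) = -κ * oddCoeff κ k := by
  unfold oddCoeff evenCoeff
  by_cases h : Odd k
  · obtain ⟨m, rfl⟩ := h
    have h1 : Even (2 * m + 1 + 1) := ⟨m + 1, by ring⟩
    have h2 : Odd (2 * m + 1) := ⟨m, rfl⟩
    rw [if_pos h1, if_pos h2, show (2 * m + 1 + 1) / 2 = m + 1 by lia,
      show (2 * m + 1 - 1) / 2 = m by lia, pow_succ']
  · rw [if_neg h, if_neg (by rwa [Nat.even_add_one, Nat.not_even_iff_odd]), mul_zero]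

end Coefficients

/-! ### Induced bimodule, chain maps and cones -/

section Operators

variable {𝕜 : Type u} [Field 𝕜] {κ : 𝕜} {A : Type v} [AddCommGroup A] [Module 𝕜 A]
  {M : Type w} [AddCommGroup M] [Module 𝕜 M] {P : MRBAssDerPair 𝕜 κ A}

theorem inducedMul_apply (P : MRBAssDerPair 𝕜 κ A) (a b : A) :
    P.inducedMul a b = P.μ (P.R a) b + P.μ a (P.R b) := rfl

theorem Bimodule.inducedLeft_apply (B : P.Bimodule M) (a : A) (m : M) :
    B.inducedLeft a m = B.l (P.R a) m - B.RM (B.l a m) := rfl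

theorem Bimodule.inducedRight_apply (B : P.Bimodule M) (m : M) (a : A) :
    B.inducedRight m a = B.r m (P.R a) - B.RM (B.r m a) := rfl

theorem mul_R_R (P : MRBAssDerPair 𝕜 κ A) (a b : A) :
    P.μ (P.R a) (P.R b) = P.R (P.inducedMul a b) - (-κ) • P.μ a b := by
  rw [P.modified_rotaBaxter, inducedMul_apply]
  module

theorem R_inducedMul (P : MRBAssDerPair 𝕜 κ A) (a b : A) :
    P.R (P.inducedMul a b) = P.μ (P.R a) (P.R b) - κ • P.μ a b := by
  rw [P.modified_rotaBaxter, inducedMul_apply]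
  module

/-- `R` is multiplicative from μ_R to μ up to -κμ(a, b); the two resulting corrections, -κ(ab)c and
-κa(bc), agree. -/
theorem inducedMul_assoc (P : MRBAssDerPair 𝕜 κ A) (a b c : A) :
    P.inducedMul (P.inducedMul a b) c = P.inducedMul a (P.inducedMul b c) := by
  rw [inducedMul_apply P _ c, inducedMul_apply P a (P.inducedMul b c), R_inducedMul, R_inducedMul]
  simp only [inducedMul_apply, map_add, map_sub, map_smul, LinearMap.add_apply,
    LinearMap.sub_apply, LinearMap.smul_apply, P.assoc]
  abel

theorem Bimodule.inducedLeft_mul (B : P.Bimodule M) (a b : A) (m : M) :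
    B.inducedLeft (P.inducedMul a b) m = B.inducedLeft a (B.inducedLeft b m) := by
  have h := B.left_rotaBaxter a (B.l b m)
  simp only [B.inducedLeft_apply, R_inducedMul]
  simp only [inducedMul_apply, map_add, map_sub, map_smul, LinearMap.add_apply,
    LinearMap.sub_apply, LinearMap.smul_apply, B.left_assoc] at h ⊢
  rw [h]
  abel

theorem Bimodule.inducedRight_mul (B : P.Bimodule M) (a b : A) (m : M) :
    B.inducedRight m (P.inducedMul a b) = B.inducedRight (B.inducedRight m a) b := by
  have h := B.right_rotaBaxter b (B.r m a)
  simp only [B.inducedRight_apply, R_inducedMul]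
  simp only [inducedMul_apply, map_add, map_sub, map_smul,
    LinearMap.sub_apply, B.right_assoc] at h ⊢
  rw [h]
  abel

theorem Bimodule.inducedLeft_inducedRight (B : P.Bimodule M) (a b : A) (m : M) :
    B.inducedLeft a (B.inducedRight m b) = B.inducedRight (B.inducedLeft a m) b := by
  have h1 := B.left_rotaBaxter a (B.r m b)
  have h2 := B.right_rotaBaxter b (B.l a m)
  simp only [B.inducedLeft_apply, B.inducedRight_apply, map_add, map_sub, LinearMap.sub_apply,
    B.middle_assoc] at h1 h2 ⊢
  rw [h1, h2]
  abel

/-- The leading term f(Ra_1, …, Ra_n) is the empty-set summand of the even sum, so both parts become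
full subset sums obeying the slice recursion. -/
theorem Bimodule.phi_apply (B : P.Bimodule M) {n : ℕ} (f : Cochain 𝕜 A M n) :
    B.phi n f = mixedSum P.R (evenCoeff κ) n f -
      B.RM.compMultilinearMap (mixedSum P.R (oddCoeff κ) n f) := by
  have h1 : mixedSum P.R (evenCoeff κ) n f = P.mixed ∅ f +
      ∑ S : Finset (Fin n) with S.Nonempty ∧ Even S.card, (-κ) ^ (S.card / 2) • P.mixed S f := by
    simp only [mixedSum, LinearMap.sum_apply, LinearMap.smul_apply]
    rw [← Finset.add_sum_erase _ _ (Finset.mem_univ ∅), Finset.sum_filter]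
    congr 1
    · simp [evenCoeff, mixed]
    · rw [← Finset.add_sum_erase (a := ∅) _ _ (Finset.mem_univ ∅), if_neg (by simp), zero_add]
      refine Finset.sum_congr rfl fun S hS => ?_
      have hS' : S.Nonempty := Finset.nonempty_iff_ne_empty.2 (Finset.ne_of_mem_erase hS)
      simp only [evenCoeff, hS', true_and, ite_smul, zero_smul]
      rfl
  have h2 : B.RM.compMultilinearMap (mixedSum P.R (oddCoeff κ) n f) =
      ∑ S : Finset (Fin n) with Odd S.card,
        (-κ) ^ ((S.card - 1) / 2) • B.RM.compMultilinearMap (P.mixed S f) := by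
    rw [Finset.sum_filter]
    ext a
    simp only [mixedSum, oddCoeff, LinearMap.compMultilinearMap_apply, LinearMap.sum_apply,
      sum_apply, map_sum]
    refine Finset.sum_congr rfl fun S _ => ?_
    split_ifs <;> simp [mixed]
  rw [h1, h2]
  simp only [phi, LinearMap.add_apply, LinearMap.sub_apply, LinearMap.sum_apply,
    LinearMap.smul_apply, LinearMap.comp_apply, LinearMap.compMultilinearMapₗ_apply]
  abel

theorem Bimodule.phi_contract (B : P.Bimodule M) {n : ℕ} (i : Fin n) (f : Cochain 𝕜 A M n) :
    B.phi (n + 1) (contract P.μ i f) = contract P.inducedMul i (B.phi n f) := by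
  rw [phi_apply, phi_apply, mixedSum_contract P.μ P.inducedMul P.R (-κ) (inducedMul_apply P)
      (mul_R_R P) _ fun k => by rw [evenCoeff_succ, oddCoeff_succ],
    mixedSum_contract P.μ P.inducedMul P.R (-κ) (inducedMul_apply P)
      (mul_R_R P) _ fun k => by rw [oddCoeff_succ, evenCoeff_succ]]
  rfl

/-- The recursion makes the even and odd sums E and O exchange roles, with a factor -κ. What remains
is the bimodule identity for l(Ra, R_M m), with m the value of O. -/
theorem Bimodule.phi_leftAct (B : P.Bimodule M) {n : ℕ} (f : Cochain 𝕜 A M n) :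
    B.phi (n + 1) (leftAct B.l f) = leftAct B.inducedLeft (B.phi n f) := by
  simp only [phi_apply, mixedSum_leftAct, evenCoeff_succ, oddCoeff_succ, mixedSum_smul_coeff]
  ext a
  have h := B.left_rotaBaxter (a 0) (mixedSum P.R (oddCoeff κ) n f (Fin.tail a))
  simp only [sub_apply, add_apply, leftAct_apply, smul_apply, LinearMap.compMultilinearMap_apply,
    LinearMap.comp_apply, inducedLeft_apply, map_sub, map_add, map_smul] at h ⊢
  rw [h]
  module

theorem Bimodule.phi_rightAct (B : P.Bimodule M) {n : ℕ} (f : Cochain 𝕜 A M n) :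
    B.phi (n + 1) (rightAct B.r f) = rightAct B.inducedRight (B.phi n f) := by
  simp only [phi_apply, mixedSum_rightAct, evenCoeff_succ, oddCoeff_succ, mixedSum_smul_coeff]
  ext a
  have h := B.right_rotaBaxter (a (Fin.last n)) (mixedSum P.R (oddCoeff κ) n f (Fin.init a))
  simp only [sub_apply, add_apply, rightAct_apply, smul_apply, LinearMap.compMultilinearMap_apply,
    LinearMap.compl₂_apply, inducedRight_apply, map_sub, map_add, map_smul, LinearMap.sub_apply,
    LinearMap.smul_apply] at h ⊢
  rw [h]
  module

theorem Bimodule.phi_deltaHoch (B : P.Bimodule M) {n : ℕ} (f : Cochain 𝕜 A M n) :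
    B.phi (n + 1) (B.deltaHoch n f) = B.deltaMHoch n (B.phi n f) := by
  simp only [deltaHoch, deltaMHoch, hochschild_apply, map_add, map_smul, map_sum, phi_contract,
    phi_leftAct, phi_rightAct]

theorem Bimodule.Delta_apply (B : P.Bimodule M) {n : ℕ} (f : Cochain 𝕜 A M n) :
    B.Delta n f = derivSum P.d n f - B.dM.compMultilinearMap f := rfl

/-- `Δ` commutes with the Hochschild differential of any product and actions which `d` and `d_M`
derive. -/
theorem Bimodule.Delta_hochschild (B : P.Bimodule M) {μ : A →ₗ[𝕜] A →ₗ[𝕜] A}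
    {l : A →ₗ[𝕜] M →ₗ[𝕜] M} {r : M →ₗ[𝕜] A →ₗ[𝕜] M}
    (hμ : ∀ a b, P.d (μ a b) = μ (P.d a) b + μ a (P.d b))
    (hl : ∀ a m, B.dM (l a m) = l (P.d a) m + l a (B.dM m))
    (hr : ∀ a m, B.dM (r m a) = r (B.dM m) a + r m (P.d a)) {n : ℕ} (f : Cochain 𝕜 A M n) :
    B.Delta (n + 1) (hochschild μ l r n f) = hochschild μ l r n (B.Delta n f) := by
  have h1 (i : Fin n) : B.Delta (n + 1) (contract μ i f) = contract μ i (B.Delta n f) := by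
    rw [Delta_apply, Delta_apply, derivSum_contract μ P.d hμ]
    rfl
  have h2 : B.Delta (n + 1) (leftAct l f) = leftAct l (B.Delta n f) := by
    rw [Delta_apply, Delta_apply, derivSum_leftAct]
    ext a
    simp [hl]
  have h3 : B.Delta (n + 1) (rightAct r f) = rightAct r (B.Delta n f) := by
    rw [Delta_apply, Delta_apply, derivSum_rightAct]
    ext a
    simp [hr]
    abel
  simp only [hochschild_apply, map_add, map_smul, map_sum, h1, h2, h3]

theorem Bimodule.Delta_deltaHoch (B : P.Bimodule M) {n : ℕ} (f : Cochain 𝕜 A M n) :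
    B.Delta (n + 1) (B.deltaHoch n f) = B.deltaHoch n (B.Delta n f) :=
  B.Delta_hochschild P.derivation B.left_derivation B.right_derivation f

theorem Bimodule.Delta_deltaMHoch (B : P.Bimodule M) {n : ℕ} (f : Cochain 𝕜 A M n) :
    B.Delta (n + 1) (B.deltaMHoch n f) = B.deltaMHoch n (B.Delta n f) := by
  have hR (a : A) : P.d (P.R a) = P.R (P.d a) := (LinearMap.congr_fun P.comm a).symm
  have hRM (m : M) : B.dM (B.RM m) = B.RM (B.dM m) := (LinearMap.congr_fun B.comm m).symm
  -- Since `d` and `d_M` commute with `R` and `R_M`, they also derive the induced product and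
  -- actions.
  refine B.Delta_hochschild (fun a b => ?_) (fun a m => ?_) (fun a m => ?_) f
  · simp only [inducedMul_apply, map_add, P.derivation, hR]
    abel
  · simp only [inducedLeft_apply, map_add, map_sub, B.left_derivation, hR, hRM]
    abel
  · simp only [inducedRight_apply, map_add, map_sub, B.right_derivation, hR, hRM]
    abel

theorem Bimodule.Delta_phi (B : P.Bimodule M) {n : ℕ} (f : Cochain 𝕜 A M n) :
    B.Delta n (B.phi n f) = B.phi n (B.Delta n f) := by
  simp only [phi_apply, Delta_apply, map_sub, mixedSum_comp, derivSum_comp,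
    derivSum_mixedSum P.R P.d P.comm]
  ext a
  have hRM (m : M) : B.dM (B.RM m) = B.RM (B.dM m) := (LinearMap.congr_fun B.comm m).symm
  simp only [sub_apply, LinearMap.compMultilinearMap_apply, hRM]
  abel

theorem Bimodule.deltaHoch_deltaHoch (B : P.Bimodule M) {n : ℕ} (f : Cochain 𝕜 A M (n + 1)) :
    B.deltaHoch (n + 2) (B.deltaHoch (n + 1) f) = 0 :=
  hochschild_hochschild P.assoc B.left_assoc B.middle_assoc B.right_assoc f

theorem Bimodule.deltaMHoch_deltaMHoch (B : P.Bimodule M) {n : ℕ} (f : Cochain 𝕜 A M (n + 1)) :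
    B.deltaMHoch (n + 2) (B.deltaMHoch (n + 1) f) = 0 :=
  hochschild_hochschild P.inducedMul_assoc B.inducedLeft_mul B.inducedLeft_inducedRight
    B.inducedRight_mul f

theorem Bimodule.partialRB_partialRB (B : P.Bimodule M) (n : ℕ) (F : RBCochain 𝕜 A M (n + 1)) :
    B.partialRB (n + 2) (B.partialRB (n + 1) F) = 0 := by
  cases n with
  | zero =>
    refine Prod.ext (B.deltaHoch_deltaHoch F) ?_
    change -B.deltaMHoch 1 (-B.phi 1 F) - B.phi 2 (B.deltaHoch 1 F) = 0
    rw [B.phi_deltaHoch, map_neg, neg_neg, sub_self]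
  | succ n =>
    obtain ⟨f, g⟩ := F
    refine Prod.ext (B.deltaHoch_deltaHoch f) ?_
    change -B.deltaMHoch (n + 2) (-B.deltaMHoch (n + 1) g - B.phi (n + 2) f) -
      B.phi (n + 3) (B.deltaHoch (n + 2) f) = 0
    rw [B.phi_deltaHoch, map_sub, map_neg, B.deltaMHoch_deltaMHoch]
    abel

theorem Bimodule.DeltaRB_partialRB (B : P.Bimodule M) (n : ℕ) (F : RBCochain 𝕜 A M (n + 1)) :
    B.DeltaRB (n + 2) (B.partialRB (n + 1) F) = B.partialRB (n + 1) (B.DeltaRB (n + 1) F) := by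
  cases n with
  | zero =>
    refine Prod.ext (B.Delta_deltaHoch F) ?_
    change B.Delta 1 (-B.phi 1 F) = -B.phi 1 (B.Delta 1 F)
    rw [map_neg, B.Delta_phi]
  | succ n =>
    obtain ⟨f, g⟩ := F
    refine Prod.ext (B.Delta_deltaHoch f) ?_
    change B.Delta (n + 2) (-B.deltaMHoch (n + 1) g - B.phi (n + 2) f) =
      -B.deltaMHoch (n + 1) (B.Delta (n + 1) g) - B.phi (n + 2) (B.Delta (n + 2) f)
    rw [map_sub, map_neg, B.Delta_phi, B.Delta_deltaMHoch]

end Operators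

end MRBAssDerPair

theorem mainTheorem1 {𝕜 : Type u} [Field 𝕜] {κ : 𝕜} {A : Type v} [AddCommGroup A] [Module 𝕜 A]
    (P : MRBAssDerPair 𝕜 κ A) {M : Type w} [AddCommGroup M] [Module 𝕜 M]
    (B : P.Bimodule M) (n : ℕ) (hn : 1 ≤ n) :
    B.pairDifferential (n + 1) ∘ₗ B.pairDifferential n = 0 := by
  obtain ⟨n, rfl⟩ := Nat.exists_eq_add_of_le' hn
  refine LinearMap.ext fun F => ?_
  cases n with
  | zero =>
    refine Prod.ext (B.partialRB_partialRB 0 F) ?_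
    change B.partialRB 1 (-B.DeltaRB 1 F) + (-1 : 𝕜) ^ 2 • B.DeltaRB 2 (B.partialRB 1 F) = 0
    -- The sign in -Δ¹ is (-1)¹, so degree one follows the general pattern: ∂Δ and Δ∂ occur with
    -- opposite signs.
    rw [B.DeltaRB_partialRB 0, map_neg]
    simp
  | succ n =>
    obtain ⟨F, G⟩ := F
    refine Prod.ext (B.partialRB_partialRB (n + 1) F) ?_
    change B.partialRB (n + 2) (B.partialRB (n + 1) G + (-1 : 𝕜) ^ (n + 2) • B.DeltaRB (n + 2) F) +
      (-1 : 𝕜) ^ (n + 3) • B.DeltaRB (n + 3) (B.partialRB (n + 2) F) = 0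
    rw [B.DeltaRB_partialRB (n + 1), map_add, map_smul, B.partialRB_partialRB, pow_succ _ (n + 2)]
    simp
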